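/- Let $d\ge 0$ be an integer and $\Lambda>0$. Let $(b_n)_{n\in\mathbb Z^d}$ be independent real standard normal random variables on a probability space, put $Q=[-\Lambda,\Lambda]^d$, and for $n\in\mathbb Z^d$ let $$\hat\phi_n(x)=(2\Lambda)^{-d}\int_{Q}e^{ix\cdot\xi}\,e^{i\pi n\cdot\xi/\Lambda}\,d\xi ,\qquad x\in\mathbb R^d,$$ which is a real-valued function. Let $$W(x)=\sum_{n\in\mathbb Z^d}b_n\hat\phi_n(x):=\lim_{N\to\infty}\ \sum_{|n_1|,\dots,|n_d|\le N}b_n\hat\phi_n(x).$$ 1. For every sequence $F_0\subseteq F_1\subseteq\cdots$ of finite sets with union $\mathbb Z^d$ (in particular for the boxes $F_N=\{|n_j|\le N,\ 1\le j\le d\}$), almost surely, for every integer $r\ge0$, the partial sums $\sum_{n\in F_N}b_n\hat\phi_n$ converge to $W$ locally in $C^r$ as $N\to\infty$. That is, these functions and $W$ are of class $C^r$ on $\mathbb R^d$, and all derivatives of order at most $r$ converge uniformly on every compact subset of $\mathbb R^d$. 2. Almost surely, $W$ is a (real-)analytic function on $\mathbb R^d$. 3. Almost surely, for every real $\rho>d$,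 the function $(1+|x|^2)^{-\rho/2}\,W(x)$ is bounded on $\mathbb R^d$, where $|x|$ is the Euclidean norm. -/

import Mathlib

open MeasureTheory ProbabilityTheory Filter Topology

namespace RandomPotential

noncomputable section

/-- The Fourier-domain cube `[-Λ, Λ]^d`. -/
def cube (d : ℕ) (Λ : ℝ) : Set (EuclideanSpace ℝ (Fin d)) :=
  {ξ | ∀ j, ξ j ∈ Set.Icc (-Λ) Λ}

/-- The functions `φ_n(ξ) = exp(iπ n·ξ/Λ) 1_{[-Λ,Λ]^d}(ξ)`. -/
def phi {d : ℕ} (Λ : ℝ) (n : Fin d → ℤ) : EuclideanSpace ℝ (Fin d) → ℂ :=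
  (cube d Λ).indicator fun ξ =>
    Complex.exp (Complex.I * ((Real.pi * (∑ j, (n j : ℝ) * ξ j) / Λ : ℝ) : ℂ))

/-- The complex number `(2Λ)^{-d} ∫_{[-Λ,Λ]^d} exp(i x·ξ) φ_n(ξ) dξ`. -/
def phiHatC {d : ℕ} (Λ : ℝ) (n : Fin d → ℤ) (x : EuclideanSpace ℝ (Fin d)) : ℂ :=
  (((2 * Λ) ^ d)⁻¹ : ℝ) *
    ∫ ξ in cube d Λ, Complex.exp (Complex.I * ((inner ℝ x ξ : ℝ) : ℂ)) * phi Λ n ξ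

/-- The Fourier transform of `φ_n` as a real-valued function; nothing is lost in taking the real
part, see `ofReal_phiHat`. -/
def phiHat {d : ℕ} (Λ : ℝ) (n : Fin d → ℤ) (x : EuclideanSpace ℝ (Fin d)) : ℝ :=
  (phiHatC Λ n x).re

theorem neg_mem_cube_iff {d : ℕ} {Λ : ℝ} (ξ : EuclideanSpace ℝ (Fin d)) :
    -ξ ∈ cube d Λ ↔ ξ ∈ cube d Λ := by
  simp only [cube, Set.mem_ofPred_eq, Set.mem_Icc, PiLp.neg_apply]
  refine forall_congr' fun j => ⟨fun h => ⟨?_, ?_⟩, fun h => ⟨?_, ?_⟩⟩ <;> linarith [h.1, h.2]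

theorem measurableSet_cube (d : ℕ) (Λ : ℝ) : MeasurableSet (cube d Λ) := by
  have : cube d Λ = ⋂ j, (fun ξ : EuclideanSpace ℝ (Fin d) => ξ j) ⁻¹' Set.Icc (-Λ) Λ := by
    ext ξ; simp [cube]
  rw [this]
  exact MeasurableSet.iInter fun j => measurableSet_Icc.preimage (by fun_prop)

/-- The Fourier transform of `φ_n` is real valued. -/
theorem ofReal_phiHat {d : ℕ} (Λ : ℝ) (n : Fin d → ℤ) (x : EuclideanSpace ℝ (Fin d)) :
    ((phiHat Λ n x : ℝ) : ℂ) = phiHatC Λ n x := by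
  refine Complex.conj_eq_iff_re.mp ?_
  unfold phiHatC
  rw [map_mul, Complex.conj_ofReal, ← integral_conj]
  congr 1
  rw [← integral_indicator (measurableSet_cube d Λ), ← integral_indicator (measurableSet_cube d Λ),
    ← integral_neg_eq_self]
  congr 1
  funext ξ
  by_cases h : ξ ∈ cube d Λ
  · have h' := (neg_mem_cube_iff ξ).2 h
    rw [Set.indicator_of_mem h', Set.indicator_of_mem h, phi, Set.indicator_of_mem h',
      Set.indicator_of_mem h, map_mul, ← Complex.exp_conj, ← Complex.exp_conj]
    simp [neg_div]
  · have h' := fun h0 => h ((neg_mem_cube_iff ξ).1 h0)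
    rw [Set.indicator_of_notMem h', Set.indicator_of_notMem h]

/-- The partial sum of the series `∑ b_n φ̂_n` over a finite set `s ⊂ ℤ^d` of frequencies, for
a given realization `a = (b_n(ω))_n` of the coefficients. -/
def partialSum {d : ℕ} (Λ : ℝ) (a : (Fin d → ℤ) → ℝ) (s : Finset (Fin d → ℤ))
    (x : EuclideanSpace ℝ (Fin d)) : ℝ :=
  ∑ n ∈ s, a n * phiHat Λ n x

/-- The box of frequencies `n ∈ ℤ^d` with `|n_j| ≤ N` for all `j`. -/
def freqBox (d N : ℕ) : Finset (Fin d → ℤ) :=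
  Fintype.piFinset fun _ => Finset.Icc (-(N : ℤ)) N

/-- The sum `W` of the series `∑ b_n φ̂_n`: the pointwise limit, as `N → ∞`, of the partial sums
over the boxes `|n_j| ≤ N` (a junk value where the limit does not exist). -/
def W {d : ℕ} (Λ : ℝ) (a : (Fin d → ℤ) → ℝ) (x : EuclideanSpace ℝ (Fin d)) : ℝ :=
  limUnder atTop fun N : ℕ => partialSum Λ a (freqBox d N) x

/-- `F 0 ⊆ F 1 ⊆ ⋯` are finite sets whose union is everything. -/
def IsExhaustion {ι : Type*} (F : ℕ → Finset ι) : Prop :=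
  Monotone F ∧ ∀ i, ∃ N, i ∈ F N

/-- Convergence locally in `C^r`: the functions are of class `C^r` and all derivatives of order at
most `r` converge uniformly on compact sets. -/
def ConvergesLocallyInCr {d : ℕ} (r : ℕ) (f : ℕ → EuclideanSpace ℝ (Fin d) → ℝ)
    (g : EuclideanSpace ℝ (Fin d) → ℝ) : Prop :=
  (∀ N, ContDiff ℝ r (f N)) ∧ ContDiff ℝ r g ∧
    ∀ K : Set (EuclideanSpace ℝ (Fin d)), IsCompact K → ∀ k : ℕ, k ≤ r →
      TendstoUniformlyOn (fun N x => iteratedFDeriv ℝ k (f N) x)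
        (fun x => iteratedFDeriv ℝ k g x) atTop K

end

end RandomPotential

/-! Write `e_n` for the character `exp(iπ n·ξ/Λ)`, orthonormal for the normalized measure on the
cube. The derivative `∂^α φ̂_n(0)` is the integral of `(iξ)^α e_n`, a Fourier coefficient of a
function bounded by `Λ^|α|`, so Bessel gives `∑_n |∂^α φ̂_n(0)|² ≤ Λ^(2|α|)`. Translation by the
lattice point `πm/Λ` turns `φ̂_n` into `φ̂_(n+m)`, so the same bound holds at every lattice point.

Hence each random series of Taylor coefficients is an `L²`-bounded martingale and converges almost
surely. After division by `(4Λ)^|α|` its variance is at most `16^(-|α|)`. Kolmogorov's maximal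
inequality and Borel–Cantelli (`ae_exists_forall_abs_sum_mul_le`) then bound all partial sums, for
all `m` and `α` at once, by a random constant times `2^(-|α|) ∏ (1+|m_j|)`.

The scaled Taylor coefficients form a vector `T` in a Banach space of bounded arrays, and the
function is the entry at `0` of `exp(4Λ ∑ x_j S_j) T`, with `S_j` the index shifts
(`phiHat_eq_expCoeff`). This is analytic in `x` and linear and continuous in `T`. Norm convergence
of the arrays therefore gives locally `C^r` convergence and analyticity. Expanding around the
lattice point nearest below `x` gives growth `O((1+|x|)^d)`, which implies the weighted bound. -/

namespace RandomPotential

/-! ### Series of independent, centred variables of unit variance. -/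

section RandomSeries

variable {Ω ι : Type*} [MeasurableSpace Ω] {P : Measure Ω} {X : ι → Ω → ℝ}

theorem memLp_sum_mul (hX : ∀ n, MemLp (X n) 2 P) (c : ι → ℝ) (s : Finset ι) :
    MemLp (fun ω => ∑ n ∈ s, c n * X n ω) 2 P :=
  memLp_finsetSum s fun n _ => (hX n).const_mul (c n)

variable [IsProbabilityMeasure P]

theorem integral_sum_mul_eq_zero (hX : ∀ n, MemLp (X n) 2 P) (hmean : ∀ n, ∫ ω, X n ω ∂P = 0)
    (c : ι → ℝ) (s : Finset ι) : ∫ ω, ∑ n ∈ s, c n * X n ω ∂P = 0 := by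
  rw [integral_finsetSum s fun n _ => ((hX n).integrable (by norm_num)).const_mul (c n)]
  exact Finset.sum_eq_zero fun n _ => by rw [integral_const_mul, hmean, mul_zero]

theorem integral_sq_sum_mul (hX : ∀ n, MemLp (X n) 2 P) (hmean : ∀ n, ∫ ω, X n ω ∂P = 0)
    (hvar : ∀ n, Var[X n; P] = 1) (hind : iIndepFun X P) (c : ι → ℝ) (s : Finset ι) :
    ∫ ω, (∑ n ∈ s, c n * X n ω) ^ 2 ∂P = ∑ n ∈ s, c n ^ 2 := by
  have h := IndepFun.variance_sum (μ := P) (X := fun n ω => c n * X n ω) (s := s)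
    (fun n _ => (hX n).const_mul (c n)) (fun i _ j _ hij =>
      (hind.indepFun hij).comp (measurable_const_mul (c i)) (measurable_const_mul (c j)))
  have h0 := integral_sum_mul_eq_zero hX hmean c s
  have hfun : (∑ n ∈ s, fun ω => c n * X n ω) = fun ω => ∑ n ∈ s, c n * X n ω := by
    ext ω; simp
  rw [hfun, variance_of_integral_eq_zero (memLp_sum_mul hX c s).aemeasurable h0] at h
  rw [h]
  exact Finset.sum_congr rfl fun n _ => by rw [variance_const_mul, hvar, mul_one]

/-- The filtration generated by the variables with index in an increasing family of finite sets. -/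
def finsetFiltration (hXm : ∀ n, Measurable (X n)) (F : ℕ → Finset ι) (hF : Monotone F) :
    Filtration ℕ ‹MeasurableSpace Ω› where
  seq N := MeasurableSpace.comap (fun ω (i : F N) => X i ω) inferInstance
  mono' := by
    intro M N hMN
    have : (fun ω (i : F M) => X i ω) =
        (fun (y : F N → ℝ) (i : F M) => y ⟨i, hF hMN i.2⟩) ∘ fun ω (i : F N) => X i ω := rfl
    change MeasurableSpace.comap _ _ ≤ MeasurableSpace.comap _ _
    rw [this, ← MeasurableSpace.comap_comp]
    refine MeasurableSpace.comap_mono (Measurable.comap_le ?_)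
    exact measurable_pi_lambda _ fun i => measurable_pi_apply _
  le' N := (measurable_pi_lambda (fun ω (i : F N) => X i ω) fun i => hXm i).comap_le

/-- An increment involves only indices outside `F N`, so it is independent of the past and its
conditional expectation is its mean, zero. -/
theorem martingale_sum_mul (hXm : ∀ n, Measurable (X n)) (hX : ∀ n, MemLp (X n) 2 P)
    (hmean : ∀ n, ∫ ω, X n ω ∂P = 0) (hind : iIndepFun X P) (c : ι → ℝ)
    (F : ℕ → Finset ι) (hF : Monotone F) :
    Martingale (fun N ω => ∑ n ∈ F N, c n * X n ω) (finsetFiltration hXm F hF) P := by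
  classical
  have hcomap : ∀ s : Finset ι, Measurable[MeasurableSpace.comap (fun ω (i : s) => X i ω)
      inferInstance] fun ω => ∑ n ∈ s, c n * X n ω := by
    intro s
    have : (fun ω => ∑ n ∈ s, c n * X n ω) =
        (fun y : s → ℝ => ∑ n : s, c n.1 * y n) ∘ fun ω (i : s) => X i ω := by
      ext ω
      exact (Finset.sum_coe_sort s fun n => c n * X n ω).symm
    rw [this]
    have hm : Measurable fun y : s → ℝ => ∑ n : s, c n.1 * y n := by fun_prop
    exact hm.comp (comap_measurable _)
  refine martingale_of_condExp_sub_eq_zero_nat (fun N => (hcomap (F N)).stronglyMeasurable)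
    (fun N => (memLp_sum_mul hX c (F N)).integrable (by norm_num)) fun N => ?_
  have hdiff : (fun ω => ∑ n ∈ F (N + 1), c n * X n ω) - (fun ω => ∑ n ∈ F N, c n * X n ω) =
      fun ω => ∑ n ∈ F (N + 1) \ F N, c n * X n ω := by
    ext ω
    simp [← Finset.sum_sdiff (hF N.le_succ)]
  rw [hdiff]
  have hi := hind.indepFun_finset (F (N + 1) \ F N) (F N) Finset.sdiff_disjoint hXm
  refine (condExp_indep_eq ?_ ((finsetFiltration hXm F hF).le N)
    (hcomap (F (N + 1) \ F N)).stronglyMeasurable ?_).trans ?_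
  · exact (measurable_pi_lambda (fun ω (i : (F (N + 1) \ F N : Finset ι)) => X i ω)
      fun i => hXm i).comap_le
  · exact (IndepFun_iff_Indep _ _ _).1 hi
  · rw [integral_sum_mul_eq_zero hX hmean]; rfl

/-- Conditional Jensen for the square; this feeds Doob's maximal inequality. -/
theorem submartingale_sq_sum_mul (hXm : ∀ n, Measurable (X n)) (hX : ∀ n, MemLp (X n) 2 P)
    (hmean : ∀ n, ∫ ω, X n ω ∂P = 0) (hind : iIndepFun X P) (c : ι → ℝ)
    (F : ℕ → Finset ι) (hF : Monotone F) :
    Submartingale (fun N ω => (∑ n ∈ F N, c n * X n ω) ^ 2) (finsetFiltration hXm F hF) P := by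
  have hM := martingale_sum_mul hXm hX hmean hind c F hF
  have hint : ∀ N, Integrable (fun ω => (∑ n ∈ F N, c n * X n ω) ^ 2) P :=
    fun N => (memLp_sum_mul hX c (F N)).integrable_sq
  refine submartingale_nat (fun N => (hM.stronglyMeasurable N).pow 2) hint fun N => ?_
  filter_upwards [hM.condExp_ae_eq N.le_succ,
    (even_two.convexOn_pow (𝕜 := ℝ)).map_condExp_le_univ ((finsetFiltration hXm F hF).le N)
      (continuous_pow 2).lowerSemicontinuous (hM.integrable (N + 1)) (hint (N + 1))] with ω h1 h2
  rw [← h1]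
  exact h2

/-- The `L¹` norms are dominated by the `L²` norms, hence by `√v`, and `L¹`-bounded martingales
converge almost surely. -/
theorem ae_tendsto_sum_mul (hXm : ∀ n, Measurable (X n)) (hX : ∀ n, MemLp (X n) 2 P)
    (hmean : ∀ n, ∫ ω, X n ω ∂P = 0) (hvar : ∀ n, Var[X n; P] = 1) (hind : iIndepFun X P)
    {c : ι → ℝ} {v : ℝ} (hc : ∀ s : Finset ι, ∑ n ∈ s, c n ^ 2 ≤ v)
    (F : ℕ → Finset ι) (hF : Monotone F) :
    ∀ᵐ ω ∂P, ∃ l, Tendsto (fun N => ∑ n ∈ F N, c n * X n ω) atTop (𝓝 l) := by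
  refine (martingale_sum_mul hXm hX hmean hind c F hF).submartingale.exists_ae_tendsto_of_bdd
    (R := Real.toNNReal (√v)) fun N => ?_
  have hL := memLp_sum_mul hX c (F N)
  refine (eLpNorm_le_eLpNorm_of_exponent_le (p := 1) (q := 2) (by norm_num)
    hL.aestronglyMeasurable).trans ?_
  rw [hL.eLpNorm_eq_integral_rpow_norm (by norm_num) (by norm_num)]
  refine ENNReal.ofReal_le_ofReal ?_
  have : ∫ ω, ‖∑ n ∈ F N, c n * X n ω‖ ^ (2 : ℝ) ∂P = ∑ n ∈ F N, c n ^ 2 := by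
    rw [← integral_sq_sum_mul hX hmean hvar hind]
    simp
  simp only [ENNReal.toReal_ofNat, this, Real.sqrt_eq_rpow]
  rw [← one_div]
  exact Real.rpow_le_rpow (Finset.sum_nonneg fun n _ => sq_nonneg _) (hc _) (by norm_num)

/-- Kolmogorov's maximal inequality. -/
theorem measure_exists_le_abs_sum_mul (hXm : ∀ n, Measurable (X n)) (hX : ∀ n, MemLp (X n) 2 P)
    (hmean : ∀ n, ∫ ω, X n ω ∂P = 0) (hvar : ∀ n, Var[X n; P] = 1) (hind : iIndepFun X P)
    {c : ι → ℝ} {v : ℝ} (hc : ∀ s : Finset ι, ∑ n ∈ s, c n ^ 2 ≤ v)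
    (F : ℕ → Finset ι) (hF : Monotone F) {l : ℝ} (hl : 0 < l) :
    P {ω | ∃ N, l ≤ |∑ n ∈ F N, c n * X n ω|} ≤ ENNReal.ofReal (v / l ^ 2) := by
  have hsub := submartingale_sq_sum_mul hXm hX hmean hind c F hF
  set A : ℕ → Set Ω := fun K => {ω | ∃ N ≤ K, l ≤ |∑ n ∈ F N, c n * X n ω|} with hA
  have hmono : Monotone A := fun K K' hK ω ⟨N, hN, h⟩ => ⟨N, hN.trans hK, h⟩
  have hU : {ω | ∃ N, l ≤ |∑ n ∈ F N, c n * X n ω|} = ⋃ K, A K := by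
    ext ω
    simp only [hA, Set.mem_ofPred_eq, Set.mem_iUnion]
    exact ⟨fun ⟨N, h⟩ => ⟨N, N, le_rfl, h⟩, fun ⟨_, N, _, h⟩ => ⟨N, h⟩⟩
  rw [hU, hmono.measure_iUnion]
  refine iSup_le fun K => ?_
  -- Doob's inequality for the squares, at level `l ^ 2`.
  have hmax := maximal_ineq hsub (fun N ω => sq_nonneg _) (ε := (l ^ 2).toNNReal) K
  have hset : {ω | (((l ^ 2).toNNReal : NNReal) : ℝ) ≤ (Finset.range (K + 1)).sup'
      Finset.nonempty_range_add_one fun k => (∑ n ∈ F k, c n * X n ω) ^ 2} = A K := by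
    ext ω
    simp only [hA, Set.mem_ofPred_eq, Finset.le_sup'_iff, Finset.mem_range, Nat.lt_succ_iff,
      Real.coe_toNNReal _ (sq_nonneg l)]
    refine exists_congr fun N => and_congr_right fun _ => ?_
    rw [sq_le_sq, abs_of_pos hl]
  rw [hset] at hmax
  have hle : ∫ ω in A K, (∑ n ∈ F K, c n * X n ω) ^ 2 ∂P ≤ v :=
    (setIntegral_le_integral (hsub.integrable K) (ae_of_all _ fun ω => sq_nonneg _)).trans
      ((integral_sq_sum_mul hX hmean hvar hind c (F K)).trans_le (hc _))
  rw [ENNReal.ofReal_div_of_pos (by positivity), ENNReal.le_div_iff_mul_le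
    (Or.inl (by simpa using hl.ne')) (Or.inl ENNReal.ofReal_ne_top), mul_comm]
  exact hmax.trans (ENNReal.ofReal_le_ofReal hle)

/-- Simultaneous bounds for countably many random series, by the Borel–Cantelli lemma. -/
theorem ae_exists_forall_abs_sum_mul_le {κ : Type*} [Countable κ]
    (hXm : ∀ n, Measurable (X n)) (hX : ∀ n, MemLp (X n) 2 P)
    (hmean : ∀ n, ∫ ω, X n ω ∂P = 0) (hvar : ∀ n, Var[X n; P] = 1) (hind : iIndepFun X P)
    {c : κ → ι → ℝ} {v l : κ → ℝ} (hc : ∀ k, ∀ s : Finset ι, ∑ n ∈ s, c k n ^ 2 ≤ v k)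
    (hl : ∀ k, 0 < l k) (hsum : Summable fun k => v k / l k ^ 2)
    (F : ℕ → Finset ι) (hF : Monotone F) :
    ∀ᵐ ω ∂P, ∃ C : ℝ, ∀ k N, |∑ n ∈ F N, c k n * X n ω| ≤ C * l k := by
  have hv : ∀ k, 0 ≤ v k := fun k => by simpa using hc k ∅
  have hBC : ∀ᵐ ω ∂P, {k | ω ∈ {ω | ∃ N, l k ≤ |∑ n ∈ F N, c k n * X n ω|}}.Finite := by
    refine ae_finite_setOfPred_mem (ne_top_of_le_ne_top ?_ (ENNReal.tsum_le_tsum fun k =>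
      measure_exists_le_abs_sum_mul hXm hX hmean hvar hind (hc k) F hF (hl k)))
    exact hsum.tsum_ofReal_ne_top
  have hconv := ae_all_iff.2 fun k => ae_tendsto_sum_mul hXm hX hmean hvar hind (hc k) F hF
  filter_upwards [hBC, hconv] with ω hfin hlim
  have hbdd : ∀ k, ∃ C : ℝ, ∀ N, |∑ n ∈ F N, c k n * X n ω| ≤ C * l k := by
    intro k
    obtain ⟨y, hy⟩ := hlim k
    obtain ⟨B, hB⟩ := hy.abs.bddAbove_range
    refine ⟨B / l k, fun N => ?_⟩
    rw [div_mul_cancel₀ _ (hl k).ne']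
    exact hB ⟨N, rfl⟩
  choose B hB using hbdd
  -- Only finitely many `k` ever reach the level `l k`. Their individual constants have a common
  -- bound; for every other `k` the constant `1` suffices.
  obtain ⟨M, hM⟩ := (hfin.image B).bddAbove
  refine ⟨max M 1, fun k N => ?_⟩
  by_cases hk : ∃ N, l k ≤ |∑ n ∈ F N, c k n * X n ω|
  · exact (hB k N).trans (mul_le_mul_of_nonneg_right
      ((hM ⟨k, hk, rfl⟩).trans (le_max_left _ _)) (hl k).le)
  · push Not at hk
    exact (hk N).le.trans (le_mul_of_one_le_left (hl k).le (le_max_right _ _))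

/-- The almost sure limit of a random series does not depend on the exhaustion. -/
theorem ae_tendsto_sub_sum_mul
    (hXm : ∀ n, Measurable (X n)) (hX : ∀ n, MemLp (X n) 2 P)
    (hmean : ∀ n, ∫ ω, X n ω ∂P = 0) (hvar : ∀ n, Var[X n; P] = 1) (hind : iIndepFun X P)
    {c : ι → ℝ} {v : ℝ} (hc : ∀ s : Finset ι, ∑ n ∈ s, c n ^ 2 ≤ v)
    {F G : ℕ → Finset ι} (hF : IsExhaustion F) (hG : IsExhaustion G) :
    ∀ᵐ ω ∂P, Tendsto (fun N => ∑ n ∈ F N, c n * X n ω - ∑ n ∈ G N, c n * X n ω) atTop (𝓝 0) := by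
  classical
  have hs : Summable fun n => c n ^ 2 := summable_of_sum_le (fun n => sq_nonneg _) hc
  have hexh : ∀ {F : ℕ → Finset ι}, IsExhaustion F → Tendsto F atTop atTop := fun {F} hF =>
    tendsto_atTop_finset_of_monotone hF.1 hF.2
  set D : ℕ → Ω → ℝ := fun N ω => ∑ n ∈ F N, c n * X n ω - ∑ n ∈ G N, c n * X n ω with hD
  -- The difference is again a weighted sum, with weights supported on the symmetric difference, so
  -- its second moment is controlled by a tail of `∑ c n ^ 2`.
  have hDform : ∀ N ω, D N ω =
      ∑ n ∈ F N ∪ G N, ((if n ∈ F N then c n else 0) - (if n ∈ G N then c n else 0)) * X n ω := by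
    intro N ω
    simp only [hD, sub_mul, ite_mul, zero_mul, Finset.sum_sub_distrib, Finset.sum_ite_mem]
    rw [Finset.inter_eq_right.2 Finset.subset_union_left,
      Finset.inter_eq_right.2 Finset.subset_union_right]
  have hsq : ∀ N, ∫ ω, D N ω ^ 2 ∂P ≤ 2 * (∑' n, c n ^ 2 - ∑ n ∈ F N ∩ G N, c n ^ 2) := by
    intro N
    simp only [hDform]
    rw [integral_sq_sum_mul hX hmean hvar hind]
    have hle : ∑ n ∈ F N ∪ G N, c n ^ 2 ≤ ∑' n, c n ^ 2 := hs.sum_le_tsum _ fun n _ => sq_nonneg _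
    have h1 : ∑ n ∈ F N ∪ G N,
        ((if n ∈ F N then c n else 0) - (if n ∈ G N then c n else 0)) ^ 2 ≤
        ∑ n ∈ F N ∪ G N, (c n ^ 2 - if n ∈ F N ∩ G N then c n ^ 2 else 0) := by
      refine Finset.sum_le_sum fun n _ => ?_
      by_cases h1 : n ∈ F N <;> by_cases h2 : n ∈ G N <;> simp [h1, h2, sq_nonneg]
    have h2 : ∑ n ∈ F N ∪ G N, (if n ∈ F N ∩ G N then c n ^ 2 else 0) =
        ∑ n ∈ F N ∩ G N, c n ^ 2 := by
      rw [Finset.sum_ite_mem, Finset.inter_eq_right.2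
        (Finset.inter_subset_left.trans Finset.subset_union_left)]
    rw [Finset.sum_sub_distrib, h2] at h1
    have h3 : ∑ n ∈ F N ∩ G N, c n ^ 2 ≤ ∑' n, c n ^ 2 := hs.sum_le_tsum _ fun n _ => sq_nonneg _
    linarith
  have hlim0 : Tendsto (fun N => ∫ ω, D N ω ^ 2 ∂P) atTop (𝓝 0) := by
    have hI : Tendsto (fun N => F N ∩ G N) atTop atTop :=
      tendsto_atTop_finset_of_monotone
        (fun M N h => Finset.inter_subset_inter (hF.1 h) (hG.1 h)) fun n => by
          obtain ⟨N, hN⟩ := hF.2 n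
          obtain ⟨M, hM⟩ := hG.2 n
          exact ⟨max N M, Finset.mem_inter.2
            ⟨hF.1 (le_max_left _ _) hN, hG.1 (le_max_right _ _) hM⟩⟩
    have h := ((hs.hasSum.comp hI).const_sub (∑' n, c n ^ 2)).const_mul 2
    rw [sub_self, mul_zero] at h
    exact squeeze_zero (fun N => integral_nonneg fun ω => sq_nonneg _) hsq h
  have hDm : ∀ N, MemLp (D N) 2 P := fun N => (memLp_sum_mul hX c _).sub (memLp_sum_mul hX c _)
  have hmeas : TendstoInMeasure P D atTop 0 := by
    refine tendstoInMeasure_of_tendsto_eLpNorm (p := 2) (by norm_num)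
      (fun N => (hDm N).aestronglyMeasurable) aestronglyMeasurable_zero ?_
    have hn : ∀ N, eLpNorm (D N - 0) 2 P = ENNReal.ofReal (√(∫ ω, D N ω ^ 2 ∂P)) := by
      intro N
      rw [sub_zero, (hDm N).eLpNorm_eq_integral_rpow_norm (by norm_num) (by norm_num)]
      simp [Real.sqrt_eq_rpow]
    simp only [hn]
    have := ENNReal.tendsto_ofReal (hlim0.sqrt)
    simpa using this
  -- Some subsequence of the differences tends to `0` almost surely; since the full sequence also
  -- converges, its limit must be `0`.
  obtain ⟨ns, hns, hsub⟩ := hmeas.exists_seq_tendsto_ae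
  filter_upwards [hsub, ae_tendsto_sum_mul hXm hX hmean hvar hind hc F hF.1,
    ae_tendsto_sum_mul hXm hX hmean hvar hind hc G hG.1] with ω h0 ⟨x, hx⟩ ⟨y, hy⟩
  have hxy : Tendsto (fun N => D N ω) atTop (𝓝 (x - y)) := hx.sub hy
  have := tendsto_nhds_unique h0 (hxy.comp hns.tendsto_atTop)
  rw [Pi.zero_apply] at this
  rw [this]
  exact hxy

end RandomSeries

/-! ### Characters on the cube and lattice translations. -/

section Cube

variable {d : ℕ} {Λ : ℝ}

theorem cube_eq_preimage_pi (d : ℕ) (Λ : ℝ) :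
    cube d Λ = WithLp.ofLp ⁻¹' Set.univ.pi fun _ : Fin d => Set.Icc (-Λ) Λ := by
  ext ξ; simp only [cube, Set.mem_ofPred_eq, Set.mem_preimage, Set.mem_univ_pi]

theorem volume_cube (d : ℕ) (Λ : ℝ) :
    volume (cube d Λ) = ENNReal.ofReal (2 * Λ) ^ d := by
  rw [cube_eq_preimage_pi, (PiLp.volume_preserving_ofLp (Fin d)).measure_preimage
    (MeasurableSet.univ_pi fun _ => measurableSet_Icc).nullMeasurableSet, volume_pi_pi]
  simp [two_mul]

/-- The normalized Lebesgue measure on the cube. -/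
noncomputable def cubeMeasure (d : ℕ) (Λ : ℝ) : Measure (EuclideanSpace ℝ (Fin d)) :=
  ENNReal.ofReal ((2 * Λ) ^ d)⁻¹ • volume.restrict (cube d Λ)

theorem isProbabilityMeasure_cubeMeasure (d : ℕ) (hΛ : 0 < Λ) :
    IsProbabilityMeasure (cubeMeasure d Λ) := by
  refine ⟨?_⟩
  rw [cubeMeasure, Measure.smul_apply, Measure.restrict_apply_univ, volume_cube,
    ← ENNReal.ofReal_pow (by positivity), smul_eq_mul, ← ENNReal.ofReal_mul (by positivity),
    inv_mul_cancel₀ (by positivity), ENNReal.ofReal_one]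

theorem integral_cubeMeasure (hΛ : 0 < Λ) (f : EuclideanSpace ℝ (Fin d) → ℂ) :
    ∫ ξ, f ξ ∂cubeMeasure d Λ = (((2 * Λ) ^ d)⁻¹ : ℝ) * ∫ ξ in cube d Λ, f ξ := by
  rw [cubeMeasure, integral_smul_measure, ENNReal.toReal_ofReal (by positivity),
    Complex.real_smul]

theorem ae_mem_cube (d : ℕ) (Λ : ℝ) : ∀ᵐ ξ ∂cubeMeasure d Λ, ξ ∈ cube d Λ :=
  Measure.ae_smul_measure (ae_restrict_mem (measurableSet_cube d Λ)) _

/-- The characters `exp(iπ n·ξ/Λ)` of the torus `ℝ^d / 2Λℤ^d`. -/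
noncomputable def torusChar (Λ : ℝ) (n : Fin d → ℤ) (ξ : EuclideanSpace ℝ (Fin d)) : ℂ :=
  Complex.exp (Complex.I * ((Real.pi * (∑ j, (n j : ℝ) * ξ j) / Λ : ℝ) : ℂ))

theorem continuous_torusChar (Λ : ℝ) (n : Fin d → ℤ) : Continuous (torusChar Λ n) := by
  unfold torusChar
  fun_prop

theorem norm_torusChar (Λ : ℝ) (n : Fin d → ℤ) (ξ : EuclideanSpace ℝ (Fin d)) :
    ‖torusChar Λ n ξ‖ = 1 :=
  Complex.norm_exp_I_mul_ofReal _

theorem torusChar_add (Λ : ℝ) (m n : Fin d → ℤ) (ξ : EuclideanSpace ℝ (Fin d)) :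
    torusChar Λ (m + n) ξ = torusChar Λ m ξ * torusChar Λ n ξ := by
  rw [torusChar, torusChar, torusChar, ← Complex.exp_add, ← mul_add, ← Complex.ofReal_add]
  congr 3
  simp [add_mul, Finset.sum_add_distrib]
  ring

theorem conj_torusChar (Λ : ℝ) (n : Fin d → ℤ) (ξ : EuclideanSpace ℝ (Fin d)) :
    starRingEnd ℂ (torusChar Λ n ξ) = torusChar Λ (-n) ξ := by
  rw [torusChar, torusChar, ← Complex.exp_conj]
  simp [neg_div]

theorem integral_Icc_exp (hΛ : 0 < Λ) (k : ℤ) :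
    ∫ t in Set.Icc (-Λ) Λ, Complex.exp (Complex.I * ((Real.pi * (k * t) / Λ : ℝ) : ℂ)) =
      if k = 0 then ((2 * Λ : ℝ) : ℂ) else 0 := by
  rw [integral_Icc_eq_integral_Ioc, ← intervalIntegral.integral_of_le (by linarith)]
  have hΛ' : (Λ : ℂ) ≠ 0 := by exact_mod_cast hΛ.ne'
  split_ifs with hk
  · simp [hk, two_mul]
  · have hc : Complex.I * Real.pi * k / Λ ≠ 0 := by
      have : (k : ℂ) ≠ 0 := by exact_mod_cast hk
      have hpi : (Real.pi : ℂ) ≠ 0 := by exact_mod_cast Real.pi_ne_zero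
      exact div_ne_zero (mul_ne_zero (mul_ne_zero Complex.I_ne_zero hpi) this) hΛ'
    have hf : ∀ t : ℝ, Complex.exp (Complex.I * ((Real.pi * (k * t) / Λ : ℝ) : ℂ)) =
        Complex.exp (Complex.I * Real.pi * k / Λ * t) := by
      intro t
      congr 1
      push_cast
      ring
    simp only [hf]
    rw [integral_exp_mul_complex hc, div_eq_zero_iff, sub_eq_zero]
    -- The exponents at `Λ` and `-Λ` are `iπk` and `-iπk`; they differ by `2πik`.
    refine Or.inl (Complex.exp_eq_exp_iff_exists_int.2 ⟨k, ?_⟩)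
    push_cast
    field_simp
    ring

/-- The character factors over the coordinates, so Fubini reduces to one dimension. Orthonormality
follows because `conj e_m * e_n` is the character of `n - m`. -/
theorem integral_torusChar (hΛ : 0 < Λ) (n : Fin d → ℤ) :
    ∫ ξ, torusChar Λ n ξ ∂cubeMeasure d Λ = if n = 0 then 1 else 0 := by
  have hprod : ∀ ξ : EuclideanSpace ℝ (Fin d), torusChar Λ n ξ =
      ∏ j, Complex.exp (Complex.I * ((Real.pi * (n j * ξ.ofLp j) / Λ : ℝ) : ℂ)) := by
    intro ξ
    rw [torusChar, ← Complex.exp_sum, ← Finset.mul_sum, ← Complex.ofReal_sum,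
      ← Finset.sum_div, ← Finset.mul_sum]
  have hvol : ∫ ξ in cube d Λ, torusChar Λ n ξ =
      ∏ j, if n j = 0 then ((2 * Λ : ℝ) : ℂ) else 0 := by
    simp only [hprod]
    rw [cube_eq_preimage_pi, (PiLp.volume_preserving_ofLp (Fin d)).setIntegral_preimage_emb
      (MeasurableEquiv.toLp 2 (Fin d → ℝ)).symm.measurableEmbedding
      (fun y : Fin d → ℝ =>
        ∏ j, Complex.exp (Complex.I * ((Real.pi * (n j * y j) / Λ : ℝ) : ℂ))),
      volume_pi, Measure.restrict_pi_pi,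
      integral_fintype_prod_eq_prod fun j (t : ℝ) =>
        Complex.exp (Complex.I * ((Real.pi * (n j * t) / Λ : ℝ) : ℂ))]
    exact Finset.prod_congr rfl fun j _ => integral_Icc_exp hΛ (n j)
  rw [integral_cubeMeasure hΛ, hvol]
  split_ifs with h
  · subst h
    simp only [Pi.zero_apply, if_true, Finset.prod_const, Finset.card_univ, Fintype.card_fin]
    rw [← Complex.ofReal_pow, ← Complex.ofReal_mul, inv_mul_cancel₀ (by positivity),
      Complex.ofReal_one]
  · obtain ⟨j, hj⟩ := Function.ne_iff.1 h
    rw [Finset.prod_eq_zero (Finset.mem_univ j) (if_neg hj), mul_zero]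

theorem phiHatC_eq_integral (hΛ : 0 < Λ) (n : Fin d → ℤ) (x : EuclideanSpace ℝ (Fin d)) :
    phiHatC Λ n x = ∫ ξ, Complex.exp (Complex.I * ((inner ℝ x ξ : ℝ) : ℂ)) * torusChar Λ n ξ
      ∂cubeMeasure d Λ := by
  rw [phiHatC, integral_cubeMeasure hΛ]
  congr 1
  refine setIntegral_congr_fun (measurableSet_cube d Λ) fun ξ hξ => ?_
  simp only [phi, Set.indicator_of_mem hξ, torusChar]

/-- Translating `φ̂_n` by a point of the lattice `(π/Λ)ℤ^d` shifts the index `n`. -/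
theorem phiHat_add_lattice (hΛ : 0 < Λ) (n m : Fin d → ℤ) (x : EuclideanSpace ℝ (Fin d)) :
    phiHat Λ n (WithLp.toLp 2 (fun j => Real.pi / Λ * m j) + x) = phiHat Λ (n + m) x := by
  rw [phiHat, phiHat, phiHatC_eq_integral hΛ, phiHatC_eq_integral hΛ]
  congr 2
  ext ξ
  rw [torusChar_add, inner_add_left, Complex.ofReal_add, mul_add, Complex.exp_add]
  have : Complex.exp (Complex.I *
      ((inner ℝ (WithLp.toLp 2 (fun j => Real.pi / Λ * m j)) ξ : ℝ) : ℂ)) = torusChar Λ m ξ := by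
    rw [torusChar]
    congr 3
    simp only [PiLp.inner_apply, RCLike.inner_apply, conj_trivial, Finset.mul_sum, Finset.sum_div]
    exact Finset.sum_congr rfl fun j _ => by ring
  rw [this]
  ring

end Cube

/-- Bessel's inequality for an orthonormal family of functions. -/
theorem sum_sq_norm_integral_conj_mul_le {α ι : Type*} [MeasurableSpace α] {ν : Measure α}
    [DecidableEq ι] {e : ι → α → ℂ} (he : ∀ n, MemLp (e n) 2 ν)
    (horth : ∀ m n, ∫ a, starRingEnd ℂ (e m a) * e n a ∂ν = if m = n then 1 else 0)
    {g : α → ℂ} (hg : MemLp g 2 ν) (s : Finset ι) :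
    ∑ n ∈ s, ‖∫ a, starRingEnd ℂ (e n a) * g a ∂ν‖ ^ 2 ≤ ∫ a, ‖g a‖ ^ 2 ∂ν := by
  have hinner : ∀ {u v : α → ℂ} (hu : MemLp u 2 ν) (hv : MemLp v 2 ν),
      inner ℂ (hu.toLp u) (hv.toLp v) = ∫ a, starRingEnd ℂ (u a) * v a ∂ν := by
    intro u v hu hv
    rw [L2.inner_def]
    refine integral_congr_ae ?_
    filter_upwards [hu.coeFn_toLp, hv.coeFn_toLp] with a h1 h2
    rw [h1, h2, RCLike.inner_apply, mul_comm]
  have ho : Orthonormal ℂ fun n => (he n).toLp (e n) :=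
    orthonormal_iff_ite.2 fun m n => by rw [hinner, horth]
  have h := ho.sum_inner_products_le (x := hg.toLp g) (s := s)
  simp only [hinner] at h
  refine h.trans_eq ?_
  have h2 : ((‖hg.toLp g‖ ^ 2 : ℝ) : ℂ) = ((∫ a, ‖g a‖ ^ 2 ∂ν : ℝ) : ℂ) := by
    have := inner_self_eq_norm_sq_to_K (𝕜 := ℂ) (hg.toLp g)
    rw [hinner] at this
    rw [← integral_complex_ofReal]
    push_cast
    refine this.symm.trans (integral_congr_ae (ae_of_all _ fun a => ?_))
    simp only [Complex.conj_mul']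
  exact_mod_cast h2

/-! ### Functions of the form `x ↦ ε (exp (A x) T)` and their dependence on `T`. -/

section ExpCoeff

variable {E H : Type*} [NormedAddCommGroup E] [NormedSpace ℝ E]
  [NormedAddCommGroup H] [NormedSpace ℝ H]

/-- The functional `B ↦ ε (B T)` on operators, as a linear function of `T`. -/
noncomputable def matrixCoeff (ε : H →L[ℝ] ℝ) : H →L[ℝ] (H →L[ℝ] H) →L[ℝ] ℝ :=
  (ContinuousLinearMap.compL ℝ (H →L[ℝ] H) H ℝ ε).comp (ContinuousLinearMap.apply ℝ H)

theorem norm_matrixCoeff_le (ε : H →L[ℝ] ℝ) (T : H) : ‖matrixCoeff ε T‖ ≤ ‖ε‖ * ‖T‖ :=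
  ContinuousLinearMap.opNorm_le_bound _ (by positivity) fun B => by
    refine (ε.le_opNorm (B T)).trans ?_
    rw [mul_assoc, mul_comm ‖T‖]
    exact mul_le_mul_of_nonneg_left (B.le_opNorm T) (norm_nonneg ε)

/-- The matrix coefficient `ε (exp (A x) T)` of the exponential of an operator `A x` depending
linearly on `x`. -/
noncomputable def expCoeff (A : E →L[ℝ] H →L[ℝ] H) (ε : H →L[ℝ] ℝ) (T : H) (x : E) : ℝ :=
  matrixCoeff ε T (NormedSpace.exp (A x))

theorem expCoeff_sum {ι : Type*} (A : E →L[ℝ] H →L[ℝ] H) (ε : H →L[ℝ] ℝ) (s : Finset ι)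
    (a : ι → ℝ) (T : ι → H) (x : E) :
    expCoeff A ε (∑ n ∈ s, a n • T n) x = ∑ n ∈ s, a n * expCoeff A ε (T n) x := by
  simp [expCoeff, map_sum]

theorem tendsto_expCoeff (A : E →L[ℝ] H →L[ℝ] H) (ε : H →L[ℝ] ℝ) {T : ℕ → H} {T' : H}
    (hT : Tendsto T atTop (𝓝 T')) (x : E) :
    Tendsto (fun N => expCoeff A ε (T N) x) atTop (𝓝 (expCoeff A ε T' x)) :=
  (((matrixCoeff ε).flip (NormedSpace.exp (A x))).continuous.tendsto T').comp hT

variable [CompleteSpace H]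

theorem hasSum_expCoeff (A : E →L[ℝ] H →L[ℝ] H) (ε : H →L[ℝ] ℝ) (T : H) (x : E) :
    HasSum (fun k : ℕ => ((k.factorial : ℝ))⁻¹ * ε ((A x ^ k) T)) (expCoeff A ε T x) := by
  have h := (NormedSpace.exp_series_hasSum_exp' (𝕂 := ℝ) (A x)).mapL (matrixCoeff ε T)
  simp only [map_smul, smul_eq_mul] at h
  exact h

theorem analyticOnNhd_exp_comp (A : E →L[ℝ] H →L[ℝ] H) :
    AnalyticOnNhd ℝ (fun x => NormedSpace.exp (A x)) Set.univ := fun x _ =>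
  (NormedSpace.exp_analytic (𝕂 := ℝ) (A x)).comp (A.analyticAt x)

theorem analyticOnNhd_expCoeff (A : E →L[ℝ] H →L[ℝ] H) (ε : H →L[ℝ] ℝ) (T : H) :
    AnalyticOnNhd ℝ (expCoeff A ε T) Set.univ := fun x hx =>
  ((matrixCoeff ε T).analyticAt _).comp (analyticOnNhd_exp_comp A x hx)

theorem contDiff_exp_comp (A : E →L[ℝ] H →L[ℝ] H) (r : ℕ) :
    ContDiff ℝ r (fun x => NormedSpace.exp (A x)) :=
  contDiffOn_univ.1 (analyticOnNhd_exp_comp A).contDiffOn_of_completeSpace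

theorem contDiff_expCoeff (A : E →L[ℝ] H →L[ℝ] H) (ε : H →L[ℝ] ℝ) (T : H) (r : ℕ) :
    ContDiff ℝ r (expCoeff A ε T) :=
  (matrixCoeff ε T).contDiff.comp (contDiff_exp_comp A r)

/-- `T` enters only through a linear functional applied to the fixed smooth map `x ↦ exp (A x)`,
whose derivatives are bounded on compact sets. The error is thus at most a constant times `‖T N -
T'‖`. -/
theorem tendstoUniformlyOn_iteratedFDeriv_expCoeff (A : E →L[ℝ] H →L[ℝ] H) (ε : H →L[ℝ] ℝ)
    {T : ℕ → H} {T' : H} (hT : Tendsto T atTop (𝓝 T')) {K : Set E} (hK : IsCompact K) (k : ℕ) :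
    TendstoUniformlyOn (fun N x => iteratedFDeriv ℝ k (expCoeff A ε (T N)) x)
      (fun x => iteratedFDeriv ℝ k (expCoeff A ε T') x) atTop K := by
  set f : E → H →L[ℝ] H := fun x => NormedSpace.exp (A x)
  have hf : ContDiff ℝ k f := contDiff_exp_comp A k
  have hder : ∀ S x, iteratedFDeriv ℝ k (expCoeff A ε S) x =
      (matrixCoeff ε S).compContinuousMultilinearMap (iteratedFDeriv ℝ k f x) := fun S x =>
    (matrixCoeff ε S).iteratedFDeriv_comp_left (hf.contDiffAt (x := x)) le_rfl
  obtain ⟨B, hB⟩ := hK.exists_bound_of_continuousOn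
    (hf.continuous_iteratedFDeriv le_rfl).continuousOn
  rw [Metric.tendstoUniformlyOn_iff]
  intro δ hδ
  have hlim : Tendsto (fun N => ‖ε‖ * ‖T N - T'‖ * B) atTop (𝓝 0) := by
    simpa using ((tendsto_iff_norm_sub_tendsto_zero.1 hT).const_mul ‖ε‖).mul_const B
  filter_upwards [hlim.eventually_lt_const hδ] with N hN x hx
  rw [dist_eq_norm, hder, hder]
  have : (matrixCoeff ε T').compContinuousMultilinearMap (iteratedFDeriv ℝ k f x) -
      (matrixCoeff ε (T N)).compContinuousMultilinearMap (iteratedFDeriv ℝ k f x) =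
      (matrixCoeff ε T' - matrixCoeff ε (T N)).compContinuousMultilinearMap
        (iteratedFDeriv ℝ k f x) := by
    ext v; simp
  rw [this]
  refine ((ContinuousLinearMap.norm_compContinuousMultilinearMap_le _ _).trans ?_).trans_lt hN
  refine mul_le_mul ?_ (hB x hx) (norm_nonneg _) (by positivity)
  rw [← map_sub, norm_sub_rev (T N)]
  exact norm_matrixCoeff_le ε _

theorem exists_abs_expCoeff_le (A : E →L[ℝ] H →L[ℝ] H) (ε : H →L[ℝ] ℝ) {K : Set E}
    (hK : IsCompact K) :
    ∃ B : ℝ, 0 ≤ B ∧ ∀ x ∈ K, ∀ T : H, |expCoeff A ε T x| ≤ B * ‖T‖ := by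
  obtain ⟨B, hB⟩ := hK.exists_bound_of_continuousOn (contDiff_exp_comp A 0).continuous.continuousOn
  refine ⟨‖ε‖ * max B 0, by positivity, fun x hx T => ?_⟩
  rw [mul_assoc]
  refine (ε.le_opNorm _).trans (mul_le_mul_of_nonneg_left ?_ (norm_nonneg ε))
  refine ((NormedSpace.exp (A x)).le_opNorm T).trans
    (mul_le_mul_of_nonneg_right ?_ (norm_nonneg T))
  exact (hB x hx).trans (le_max_left _ _)

end ExpCoeff

/-! ### The Banach space of Taylor arrays and its shift operators. -/

section TaylorArray

variable {d : ℕ}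

/-- Bounded arrays of real numbers indexed by multi-indices. -/
def TaylorArray (d : ℕ) : Type := BoundedContinuousFunction (Fin d → ℕ) ℝ

noncomputable instance : NormedAddCommGroup (TaylorArray d) :=
  inferInstanceAs (NormedAddCommGroup (BoundedContinuousFunction (Fin d → ℕ) ℝ))

noncomputable instance : NormedSpace ℝ (TaylorArray d) :=
  inferInstanceAs (NormedSpace ℝ (BoundedContinuousFunction (Fin d → ℕ) ℝ))

instance : CompleteSpace (TaylorArray d) :=
  inferInstanceAs (CompleteSpace (BoundedContinuousFunction (Fin d → ℕ) ℝ))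

namespace TaylorArray

/-- The array with given entries. -/
noncomputable def mk (f : (Fin d → ℕ) → ℝ) (C : ℝ) (hf : ∀ α, |f α| ≤ C) : TaylorArray d :=
  BoundedContinuousFunction.ofNormedAddCommGroupDiscrete f C hf

/-- The entry of an array at a multi-index. -/
noncomputable def coeff (α : Fin d → ℕ) : TaylorArray d →L[ℝ] ℝ :=
  BoundedContinuousFunction.evalCLM ℝ α

theorem coeff_mk (f : (Fin d → ℕ) → ℝ) (C : ℝ) (hf : ∀ α, |f α| ≤ C) (α : Fin d → ℕ) :
    coeff α (mk f C hf) = f α := rfl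

theorem abs_coeff_le_norm (T : TaylorArray d) (α : Fin d → ℕ) : |coeff α T| ≤ ‖T‖ :=
  BoundedContinuousFunction.norm_coe_le_norm (show BoundedContinuousFunction _ _ from T) α

theorem norm_le {T : TaylorArray d} {C : ℝ} (hC : 0 ≤ C) (h : ∀ α, |coeff α T| ≤ C) : ‖T‖ ≤ C :=
  (BoundedContinuousFunction.norm_le (f := (show BoundedContinuousFunction _ _ from T)) hC).2 h

/-- The operator mapping an array `T` to the array `α ↦ T (α + e_j)`. -/
noncomputable def shift (j : Fin d) : TaylorArray d →L[ℝ] TaylorArray d :=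
  LinearMap.mkContinuous
    { toFun := fun T => mk (fun α => coeff (α + Pi.single j 1) T) ‖T‖ fun α =>
        abs_coeff_le_norm T _
      map_add' := fun _ _ => rfl
      map_smul' := fun _ _ => rfl } 1 fun T => by
    rw [one_mul]
    exact norm_le (norm_nonneg T) fun α => abs_coeff_le_norm T _

theorem coeff_shift (j : Fin d) (T : TaylorArray d) (α : Fin d → ℕ) :
    coeff α (shift j T) = coeff (α + Pi.single j 1) T := rfl

/-- The operator `R ∑ x_j shift_j`, as a linear function of `x`. -/
noncomputable def shiftComb (R : ℝ) :
    EuclideanSpace ℝ (Fin d) →L[ℝ] TaylorArray d →L[ℝ] TaylorArray d :=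
  R • ∑ j, (EuclideanSpace.proj j : EuclideanSpace ℝ (Fin d) →L[ℝ] ℝ).smulRight (shift j)

theorem coeff_shiftComb (R : ℝ) (x : EuclideanSpace ℝ (Fin d)) (T : TaylorArray d)
    (α : Fin d → ℕ) :
    coeff α (shiftComb R x T) = R * ∑ j, x j * coeff (α + Pi.single j 1) T := by
  simp [shiftComb, coeff_shift]

/-- Coefficientwise convergence of arrays dominated by a summable array is convergence in norm. -/
theorem exists_tendsto_of_dominated {T : ℕ → TaylorArray d} {w : (Fin d → ℕ) → ℝ}
    (hw : Summable w) (hT : ∀ N α, |coeff α (T N)| ≤ w α) {l : (Fin d → ℕ) → ℝ}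
    (hl : ∀ α, Tendsto (fun N => coeff α (T N)) atTop (𝓝 (l α))) :
    ∃ T' : TaylorArray d, (∀ α, coeff α T' = l α) ∧ Tendsto T atTop (𝓝 T') := by
  have hw0 : ∀ α, 0 ≤ w α := fun α => (abs_nonneg _).trans (hT 0 α)
  have hlw : ∀ α, |l α| ≤ w α := fun α =>
    le_of_tendsto (hl α).abs (Eventually.of_forall fun N => hT N α)
  refine ⟨mk l (∑' α, w α) fun α =>
    (hlw α).trans (hw.le_tsum α fun β _ => hw0 β), fun α => rfl, ?_⟩
  rw [tendsto_iff_norm_sub_tendsto_zero]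
  have hbound : ∀ N α, |coeff α (T N) - l α| ≤ 2 * w α := fun N α =>
    (abs_sub _ _).trans (by linarith [hT N α, hlw α])
  have hsN : ∀ N, Summable fun α => |coeff α (T N) - l α| := fun N =>
    Summable.of_nonneg_of_le (fun α => abs_nonneg _) (hbound N) (hw.mul_left 2)
  have hlim : Tendsto (fun N => ∑' α, |coeff α (T N) - l α|) atTop (𝓝 0) := by
    have h := tendsto_tsum_of_dominated_convergence (𝓕 := atTop)
      (f := fun N α => |coeff α (T N) - l α|)
      (g := fun _ => 0) (hw.mul_left 2) (fun α => by
        simpa using ((hl α).sub_const (l α)).abs)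
      (Eventually.of_forall fun N α => by simpa using hbound N α)
    simpa using h
  refine squeeze_zero (fun N => norm_nonneg _) (fun N => ?_) hlim
  refine norm_le (tsum_nonneg fun α => abs_nonneg _) fun α => ?_
  rw [map_sub, coeff_mk]
  exact (hsN N).le_tsum α fun β _ => abs_nonneg _

end TaylorArray

end TaylorArray

/-! ### Taylor coefficients of `φ̂_n`: Bessel bounds and resummation. -/

section TaylorCoefficients

variable {d : ℕ} {Λ : ℝ}

theorem isCompact_cube (d : ℕ) (Λ : ℝ) : IsCompact (cube d Λ) := by
  have h : cube d Λ = WithLp.toLp 2 '' Set.univ.pi fun _ : Fin d => Set.Icc (-Λ) Λ := by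
    rw [cube_eq_preimage_pi]
    ext ξ
    exact ⟨fun h => ⟨_, h, rfl⟩, by rintro ⟨y, hy, rfl⟩; exact hy⟩
  rw [h]
  exact (isCompact_univ_pi fun _ => isCompact_Icc).image (PiLp.continuous_toLp 2 _)

theorem integrable_cubeMeasure {f : EuclideanSpace ℝ (Fin d) → ℂ} (hf : Continuous f) (Λ : ℝ) :
    Integrable f (cubeMeasure d Λ) :=
  (hf.continuousOn.integrableOn_compact (isCompact_cube d Λ)).smul_measure ENNReal.ofReal_ne_top

/-- The monomial `(iξ)^α`. -/
noncomputable def monomial (α : Fin d → ℕ) (ξ : EuclideanSpace ℝ (Fin d)) : ℂ :=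
  ∏ j, (Complex.I * (ξ j : ℂ)) ^ α j

theorem continuous_monomial (α : Fin d → ℕ) : Continuous (monomial α) := by
  unfold monomial
  fun_prop

theorem monomial_zero (ξ : EuclideanSpace ℝ (Fin d)) : monomial 0 ξ = 1 := by
  simp [monomial]

theorem monomial_add_single (α : Fin d → ℕ) (j : Fin d) (ξ : EuclideanSpace ℝ (Fin d)) :
    monomial (α + Pi.single j 1) ξ = Complex.I * (ξ j : ℂ) * monomial α ξ := by
  simp only [monomial, Pi.add_apply, pow_add, Finset.prod_mul_distrib]
  rw [mul_comm]
  congr 1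
  rw [Finset.prod_eq_single j]
  · simp
  · intro i _ hi
    simp [Pi.single_eq_of_ne hi]
  · simp

theorem norm_monomial_le (α : Fin d → ℕ) {ξ : EuclideanSpace ℝ (Fin d)} (hξ : ξ ∈ cube d Λ) :
    ‖monomial α ξ‖ ≤ Λ ^ ∑ j, α j := by
  rw [monomial, norm_prod, ← Finset.prod_pow_eq_pow_sum]
  refine Finset.prod_le_prod (fun j _ => norm_nonneg _) fun j _ => ?_
  rw [norm_pow, norm_mul, Complex.norm_I, one_mul, Complex.norm_real]
  exact pow_le_pow_left₀ (norm_nonneg _) (abs_le.2 (hξ j)) _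

/-- The Taylor coefficient `∂^α φ̂_n(0)`. -/
noncomputable def taylorCoeff (Λ : ℝ) (n : Fin d → ℤ) (α : Fin d → ℕ) : ℝ :=
  (∫ ξ, monomial α ξ * torusChar Λ n ξ ∂cubeMeasure d Λ).re

theorem sum_sq_taylorCoeff_le (hΛ : 0 < Λ) (α : Fin d → ℕ) (s : Finset (Fin d → ℤ)) :
    ∑ n ∈ s, taylorCoeff Λ n α ^ 2 ≤ (Λ ^ ∑ j, α j) ^ 2 := by
  have := isProbabilityMeasure_cubeMeasure d hΛ
  have hmem : ∀ {f : EuclideanSpace ℝ (Fin d) → ℂ}, Continuous f → ∀ C : ℝ,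
      (∀ ξ ∈ cube d Λ, ‖f ξ‖ ≤ C) → MemLp f 2 (cubeMeasure d Λ) := fun hf C hC =>
    MemLp.of_bound hf.aestronglyMeasurable C ((ae_mem_cube d Λ).mono hC)
  have hB := sum_sq_norm_integral_conj_mul_le (ν := cubeMeasure d Λ)
    -- The sign cancels the conjugation in Bessel's inequality.
    (e := fun n : Fin d → ℤ => torusChar Λ (-n))
    (fun n => hmem (continuous_torusChar Λ _) 1 fun ξ _ => (norm_torusChar Λ _ ξ).le)
    (fun m n => by
      simp only [conj_torusChar, neg_neg, ← torusChar_add]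
      rw [integral_torusChar hΛ]
      simp only [← sub_eq_add_neg, sub_eq_zero])
    (hmem (continuous_monomial α) _ fun ξ hξ => norm_monomial_le α hξ) s
  refine (Finset.sum_le_sum fun n _ => ?_).trans (hB.trans ?_)
  · rw [taylorCoeff, ← sq_abs]
    refine pow_le_pow_left₀ (abs_nonneg _) ((Complex.abs_re_le_norm _).trans_eq ?_) 2
    simp only [conj_torusChar, neg_neg, mul_comm]
  · calc ∫ ξ, ‖monomial α ξ‖ ^ 2 ∂cubeMeasure d Λ
        ≤ ∫ _, (Λ ^ ∑ j, α j) ^ 2 ∂cubeMeasure d Λ := by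
          refine integral_mono_of_nonneg (ae_of_all _ fun ξ => sq_nonneg _)
            (integrable_const _) ((ae_mem_cube d Λ).mono fun ξ hξ => ?_)
          exact pow_le_pow_left₀ (norm_nonneg _) (norm_monomial_le α hξ) 2
      _ = (Λ ^ ∑ j, α j) ^ 2 := by simp

/-- The array of scaled Taylor coefficients of `φ̂_n` at the origin. -/
noncomputable def taylorArray (hΛ : 0 < Λ) (n : Fin d → ℤ) : TaylorArray d :=
  TaylorArray.mk (fun α => taylorCoeff Λ n α / (4 * Λ) ^ ∑ j, α j) 1 fun α => by
    have h := sum_sq_taylorCoeff_le hΛ α {n}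
    rw [Finset.sum_singleton] at h
    have h1 := abs_le_of_sq_le_sq h (by positivity : 0 ≤ Λ ^ ∑ j, α j)
    rw [abs_div, abs_of_nonneg (a := (4 * Λ) ^ _) (by positivity)]
    refine div_le_one_of_le₀ (h1.trans ?_) (by positivity)
    exact pow_le_pow_left₀ hΛ.le (by linarith) _

theorem coeff_taylorArray (hΛ : 0 < Λ) (n : Fin d → ℤ) (α : Fin d → ℕ) :
    TaylorArray.coeff α (taylorArray hΛ n) = taylorCoeff Λ n α / (4 * Λ) ^ ∑ j, α j := rfl

/-- A shift by `m` merely reindexes the Bessel sum; `1 / 16` is `(Λ / (4 * Λ)) ^ 2`. -/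
theorem sum_sq_coeff_taylorArray_le (hΛ : 0 < Λ) (m : Fin d → ℤ) (α : Fin d → ℕ)
    (s : Finset (Fin d → ℤ)) :
    ∑ n ∈ s, TaylorArray.coeff α (taylorArray hΛ (n + m)) ^ 2 ≤ (1 / 16) ^ ∑ j, α j := by
  have h := sum_sq_taylorCoeff_le hΛ α (s.map (addRightEmbedding m))
  rw [Finset.sum_map] at h
  simp only [addRightEmbedding_apply] at h
  simp only [coeff_taylorArray, div_pow]
  rw [← Finset.sum_div, div_le_iff₀ (by positivity)]
  refine h.trans_eq ?_
  rw [← pow_mul, ← pow_mul, mul_comm _ 2, pow_mul, pow_mul, ← one_pow (∑ j, α j), ← div_pow,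
    ← mul_pow]
  congr 1
  ring

/-- Each application of the operator inserts a factor `i x·ξ` under the integral; the factor `4 * Λ`
compensates the rise in degree in the scaling. -/
theorem coeff_shiftComb_pow_taylorArray (hΛ : 0 < Λ) (n : Fin d → ℤ)
    (x : EuclideanSpace ℝ (Fin d)) (k : ℕ) (α : Fin d → ℕ) :
    TaylorArray.coeff α ((TaylorArray.shiftComb (4 * Λ) x ^ k) (taylorArray hΛ n)) =
      (∫ ξ, (Complex.I * ((inner ℝ x ξ : ℝ) : ℂ)) ^ k * monomial α ξ * torusChar Λ n ξ
        ∂cubeMeasure d Λ).re / (4 * Λ) ^ ∑ j, α j := by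
  induction k generalizing α with
  | zero => simp [coeff_taylorArray, taylorCoeff]
  | succ k ih =>
    have hc := continuous_torusChar Λ n
    have hint : ∀ j, Integrable (fun ξ => (x j : ℂ) *
        ((Complex.I * ((inner ℝ x ξ : ℝ) : ℂ)) ^ k * monomial (α + Pi.single j 1) ξ *
          torusChar Λ n ξ)) (cubeMeasure d Λ) := by
      intro j
      have hm := continuous_monomial (α + Pi.single j 1)
      exact integrable_cubeMeasure (by fun_prop) Λ
    have hsum : ∫ ξ, (Complex.I * ((inner ℝ x ξ : ℝ) : ℂ)) ^ (k + 1) * monomial α ξ *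
        torusChar Λ n ξ ∂cubeMeasure d Λ = ∑ j, (x j : ℂ) *
        ∫ ξ, (Complex.I * ((inner ℝ x ξ : ℝ) : ℂ)) ^ k * monomial (α + Pi.single j 1) ξ *
          torusChar Λ n ξ ∂cubeMeasure d Λ := by
      simp only [← integral_const_mul]
      rw [← integral_finsetSum _ fun j _ => hint j]
      congr 1
      ext ξ
      have hin : ((inner ℝ x ξ : ℝ) : ℂ) = ∑ j, (x j : ℂ) * (ξ j : ℂ) := by
        simp [PiLp.inner_apply, mul_comm]
      simp only [monomial_add_single]
      rw [pow_succ]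
      nth_rewrite 2 [hin]
      simp only [Finset.mul_sum, Finset.sum_mul]
      exact Finset.sum_congr rfl fun j _ => by ring
    rw [pow_succ', mul_apply_eq_comp, TaylorArray.coeff_shiftComb, hsum,
      Complex.re_sum, Finset.mul_sum, Finset.sum_div]
    refine Finset.sum_congr rfl fun j _ => ?_
    have hdeg : ∑ i, (α + Pi.single j 1 : Fin d → ℕ) i = ∑ i, α i + 1 := by
      simp [Finset.sum_add_distrib]
    rw [ih, hdeg, Complex.re_ofReal_mul, pow_succ]
    have : (4 * Λ) ^ ∑ i, α i ≠ 0 := by positivity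
    field_simp

/-- `φ̂_n` is the sum of its Taylor series. -/
theorem phiHat_eq_expCoeff (hΛ : 0 < Λ) (n : Fin d → ℤ) (x : EuclideanSpace ℝ (Fin d)) :
    phiHat Λ n x = expCoeff (TaylorArray.shiftComb (4 * Λ)) (TaylorArray.coeff 0)
      (taylorArray hΛ n) x := by
  have := isProbabilityMeasure_cubeMeasure d hΛ
  have hseries := hasSum_expCoeff (TaylorArray.shiftComb (4 * Λ)) (TaylorArray.coeff 0)
    (taylorArray hΛ n) x
  refine HasSum.unique ?_ hseries
  simp only [coeff_shiftComb_pow_taylorArray, Pi.zero_apply, Finset.sum_const_zero, pow_zero,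
    div_one, monomial_zero, mul_one]
  set f : ℕ → EuclideanSpace ℝ (Fin d) → ℂ := fun k ξ =>
    ((k.factorial : ℝ)⁻¹ : ℝ) * ((Complex.I * ((inner ℝ x ξ : ℝ) : ℂ)) ^ k * torusChar Λ n ξ)
  have hc := continuous_torusChar Λ n
  have hf : ∀ k, Integrable (f k) (cubeMeasure d Λ) := fun k =>
    integrable_cubeMeasure (by fun_prop) Λ
  obtain ⟨B, hB⟩ := (isCompact_cube d Λ).exists_bound_of_continuousOn (f := fun ξ => inner ℝ x ξ)
    (by fun_prop)
  have hnorm : ∀ k, ∫ ξ, ‖f k ξ‖ ∂cubeMeasure d Λ ≤ |B| ^ k / k.factorial := by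
    intro k
    calc ∫ ξ, ‖f k ξ‖ ∂cubeMeasure d Λ ≤ ∫ _, |B| ^ k / k.factorial ∂cubeMeasure d Λ := by
          refine integral_mono_of_nonneg (ae_of_all _ fun ξ => norm_nonneg _)
            (integrable_const _) ((ae_mem_cube d Λ).mono fun ξ hξ => ?_)
          simp only [f, norm_mul, norm_pow, norm_torusChar, Complex.norm_I, one_mul, mul_one,
            Complex.norm_real]
          rw [norm_inv, Real.norm_natCast, inv_mul_eq_div]
          gcongr
          exact (hB ξ hξ).trans (le_abs_self B)
      _ = |B| ^ k / k.factorial := by simp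
  have hsum := hasSum_integral_of_summable_integral_norm hf
    (Summable.of_nonneg_of_le (fun k => integral_nonneg fun ξ => norm_nonneg _) hnorm
      (Real.summable_pow_div_factorial |B|))
  have htsum : ∀ ξ, ∑' k, f k ξ =
      Complex.exp (Complex.I * ((inner ℝ x ξ : ℝ) : ℂ)) * torusChar Λ n ξ := by
    intro ξ
    have h := (NormedSpace.expSeries_div_hasSum_exp
      (Complex.I * ((inner ℝ x ξ : ℝ) : ℂ))).mul_right (torusChar Λ n ξ)
    rw [← Complex.exp_eq_exp_ℂ] at h
    rw [← h.tsum_eq]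
    refine tsum_congr fun k => ?_
    simp only [f]
    push_cast
    ring
  simp only [htsum, ← phiHatC_eq_integral hΛ] at hsum
  have hre := Complex.hasSum_re hsum
  simp only [f, integral_const_mul, Complex.re_ofReal_mul] at hre
  exact hre

/-- Taylor expansion around the lattice point `πm/Λ`, which lets one compact cell of values of `x`
control all of space. -/
theorem partialSum_eq_expCoeff (hΛ : 0 < Λ) (a : (Fin d → ℤ) → ℝ) (s : Finset (Fin d → ℤ))
    (m : Fin d → ℤ) (x : EuclideanSpace ℝ (Fin d)) :
    partialSum Λ a s (WithLp.toLp 2 (fun j => Real.pi / Λ * m j) + x) =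
      expCoeff (TaylorArray.shiftComb (4 * Λ)) (TaylorArray.coeff 0)
        (∑ n ∈ s, a n • taylorArray hΛ (n + m)) x := by
  rw [expCoeff_sum, partialSum]
  exact Finset.sum_congr rfl fun n _ => by rw [phiHat_add_lattice hΛ, phiHat_eq_expCoeff hΛ]

end TaylorCoefficients

/-! ### Summability over multi-indices and lattice points. -/

section Summability

/-- A finite index set lies in the product of its projections, over which the sum factors. -/
theorem summable_pi_prod {d : ℕ} {κ : Type*} {f : κ → ℝ} (h0 : ∀ k, 0 ≤ f k) (hf : Summable f) :
    Summable fun α : Fin d → κ => ∏ j, f (α j) := by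
  classical
  refine summable_of_sum_le (c := ∏ _j : Fin d, ∑' k, f k)
    (fun α => Finset.prod_nonneg fun j _ => h0 _) fun u => ?_
  calc ∑ α ∈ u, ∏ j, f (α j)
      ≤ ∑ α ∈ Fintype.piFinset fun j => u.image fun α => α j, ∏ j, f (α j) := by
        refine Finset.sum_le_sum_of_subset_of_nonneg (fun α hα => ?_)
          fun α _ _ => Finset.prod_nonneg fun j _ => h0 _
        exact Fintype.mem_piFinset.2 fun j => Finset.mem_image_of_mem _ hα
    _ = ∏ j, ∑ k ∈ u.image fun α => α j, f k := (Finset.prod_univ_sum _ _).symm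
    _ ≤ ∏ _j : Fin d, ∑' k, f k :=
        Finset.prod_le_prod (fun j _ => Finset.sum_nonneg fun k _ => h0 k)
          fun j _ => hf.sum_le_tsum _ fun k _ => h0 k

theorem summable_pow_sum {d : ℕ} {r : ℝ} (h0 : 0 ≤ r) (h1 : r < 1) :
    Summable fun α : Fin d → ℕ => r ^ ∑ j, α j := by
  simp only [← Finset.prod_pow_eq_pow_sum]
  exact summable_pi_prod (fun k => pow_nonneg h0 k) (summable_geometric_of_lt_one h0 h1)

theorem summable_inv_sq_one_add_abs_int :
    Summable fun k : ℤ => ((1 + |(k : ℝ)|) ^ 2)⁻¹ := by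
  have h : Summable fun k : ℕ => ((1 + (k : ℝ)) ^ 2)⁻¹ := by
    have := (summable_nat_add_iff 1).2 (Real.summable_nat_pow_inv.2 one_lt_two)
    refine this.congr fun k => ?_
    push_cast
    rw [add_comm]
  refine Summable.of_nat_of_neg ?_ ?_ <;> simpa using h

end Summability

/-! ### Almost sure convergence, analyticity and growth. -/

section AlmostSure

variable {d : ℕ} {Λ : ℝ}

theorem isExhaustion_freqBox (d : ℕ) : IsExhaustion (freqBox d) := by
  refine ⟨fun M N h => Fintype.piFinset_subset _ _ fun j =>
    Finset.Icc_subset_Icc (by simpa using h) (by simpa using h), fun n => ?_⟩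
  refine ⟨∑ j, (n j).natAbs, Fintype.mem_piFinset.2 fun j => ?_⟩
  have h : (n j).natAbs ≤ ∑ j, (n j).natAbs :=
    Finset.single_le_sum (f := fun j => (n j).natAbs) (fun _ _ => Nat.zero_le _)
      (Finset.mem_univ j)
  rw [Finset.mem_Icc]
  omega

/-- If the Taylor coefficients of the partial sums converge and are suitably dominated, then the
arrays of scaled Taylor coefficients converge in norm. -/
theorem exists_tendsto_taylorArray (hΛ : 0 < Λ) {a : (Fin d → ℤ) → ℝ}
    {F : ℕ → Finset (Fin d → ℤ)} {C : ℝ} {l : (Fin d → ℕ) → ℝ}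
    (hbound : ∀ α N, |∑ n ∈ F N, TaylorArray.coeff α (taylorArray hΛ n) * a n| ≤
      C * (1 / 2) ^ ∑ j, α j)
    (hlim : ∀ α, Tendsto (fun N => ∑ n ∈ F N, TaylorArray.coeff α (taylorArray hΛ n) * a n)
      atTop (𝓝 (l α))) :
    ∃ T : TaylorArray d, (∀ α, TaylorArray.coeff α T = l α) ∧
      Tendsto (fun N => ∑ n ∈ F N, a n • taylorArray hΛ n) atTop (𝓝 T) := by
  have hcoeff : ∀ α N, TaylorArray.coeff α (∑ n ∈ F N, a n • taylorArray hΛ n) =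
      ∑ n ∈ F N, TaylorArray.coeff α (taylorArray hΛ n) * a n := by
    intro α N
    rw [map_sum]
    exact Finset.sum_congr rfl fun n _ => by rw [map_smul, smul_eq_mul, mul_comm]
  refine TaylorArray.exists_tendsto_of_dominated
    ((summable_pow_sum (by norm_num) (by norm_num : (1 / 2 : ℝ) < 1)).mul_left C)
    (fun N α => ?_) fun α => ?_
  · rw [hcoeff]; exact hbound α N
  · simp only [hcoeff]; exact hlim α

theorem partialSum_eq_expCoeff_zero (hΛ : 0 < Λ) (a : (Fin d → ℤ) → ℝ) (s : Finset (Fin d → ℤ)) :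
    partialSum Λ a s = expCoeff (TaylorArray.shiftComb (4 * Λ)) (TaylorArray.coeff 0)
      (∑ n ∈ s, a n • taylorArray hΛ n) := by
  ext x
  have h := partialSum_eq_expCoeff hΛ a s 0 x
  simp only [Pi.zero_apply, Int.cast_zero, mul_zero, add_zero] at h
  rw [← h]
  congr 1
  ext j
  simp

theorem convergesLocallyInCr_partialSum (hΛ : 0 < Λ) {a : (Fin d → ℤ) → ℝ}
    {F : ℕ → Finset (Fin d → ℤ)} {T : TaylorArray d}
    (hT : Tendsto (fun N => ∑ n ∈ F N, a n • taylorArray hΛ n) atTop (𝓝 T)) (r : ℕ) :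
    ConvergesLocallyInCr r (fun N => partialSum Λ a (F N))
      (expCoeff (TaylorArray.shiftComb (4 * Λ)) (TaylorArray.coeff 0) T) := by
  simp only [partialSum_eq_expCoeff_zero hΛ]
  exact ⟨fun N => contDiff_expCoeff _ _ _ r, contDiff_expCoeff _ _ _ r, fun K hK k _ =>
    tendstoUniformlyOn_iteratedFDeriv_expCoeff _ _ hT hK k⟩

theorem W_eq_expCoeff (hΛ : 0 < Λ) {a : (Fin d → ℤ) → ℝ} {T : TaylorArray d}
    (hT : Tendsto (fun N => ∑ n ∈ freqBox d N, a n • taylorArray hΛ n) atTop (𝓝 T)) :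
    W Λ a = expCoeff (TaylorArray.shiftComb (4 * Λ)) (TaylorArray.coeff 0) T := by
  ext x
  refine Tendsto.limUnder_eq ?_
  simp only [partialSum_eq_expCoeff_zero hΛ]
  exact tendsto_expCoeff _ _ hT x

/-- Bounds on the Taylor coefficients at all points of the lattice `(π/Λ)ℤ^d` imply a polynomial
bound for the sum. -/
theorem exists_abs_le_of_taylor_bounds (hΛ : 0 < Λ) {a : (Fin d → ℤ) → ℝ}
    {F : ℕ → Finset (Fin d → ℤ)} {C : ℝ}
    (hbound : ∀ (m : Fin d → ℤ) (α : Fin d → ℕ) N,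
      |∑ n ∈ F N, TaylorArray.coeff α (taylorArray hΛ (n + m)) * a n| ≤
      C * ((1 / 2) ^ (∑ j, α j) * ∏ j, (1 + |(m j : ℝ)|))) {f : EuclideanSpace ℝ (Fin d) → ℝ}
    (hf : ∀ x, Tendsto (fun N => partialSum Λ a (F N) x) atTop (𝓝 (f x))) :
    ∃ B : ℝ, ∀ x, |f x| ≤ B * (1 + ‖x‖) ^ d := by
  have hπ := Real.pi_pos
  have hC : 0 ≤ C := by simpa using (abs_nonneg _).trans (hbound 0 0 0)
  set K : Set (EuclideanSpace ℝ (Fin d)) :=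
    WithLp.toLp 2 '' Set.univ.pi fun _ : Fin d => Set.Icc 0 (Real.pi / Λ)
  have hK : IsCompact K :=
    (isCompact_univ_pi fun _ => isCompact_Icc).image (PiLp.continuous_toLp 2 _)
  obtain ⟨B, hB0, hB⟩ := exists_abs_expCoeff_le (TaylorArray.shiftComb (4 * Λ))
    (TaylorArray.coeff (0 : Fin d → ℕ)) hK
  refine ⟨B * (C * (2 + Λ / Real.pi) ^ d), fun x => ?_⟩
  -- The lattice point `πm/Λ` is the corner of the cell containing `x`; the remainder `y` stays in
  -- the compact cell `K`.
  set m : Fin d → ℤ := fun j => ⌊x j / (Real.pi / Λ)⌋ with hm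
  set y : EuclideanSpace ℝ (Fin d) := WithLp.toLp 2 fun j => x j - Real.pi / Λ * m j with hy
  have hxy : x = WithLp.toLp 2 (fun j => Real.pi / Λ * m j) + y := by
    ext j; simp [hy]
  have hyK : y ∈ K := by
    refine ⟨_, fun j _ => ?_, rfl⟩
    have hpos : 0 < Real.pi / Λ := by positivity
    have h1 := Int.floor_le (x j / (Real.pi / Λ))
    have h2 := (Int.lt_floor_add_one (x j / (Real.pi / Λ))).le
    rw [le_div_iff₀ hpos] at h1
    rw [div_le_iff₀ hpos] at h2
    simp only [hm, Set.mem_Icc]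
    constructor <;> nlinarith
  have hprod : ∏ j, (1 + |(m j : ℝ)|) ≤ ((2 + Λ / Real.pi) * (1 + ‖x‖)) ^ d := by
    calc ∏ j, (1 + |(m j : ℝ)|) ≤ ∏ _j : Fin d, (2 + Λ / Real.pi) * (1 + ‖x‖) := by
          refine Finset.prod_le_prod (fun j _ => by positivity) fun j _ => ?_
          have hfl : |(m j : ℝ)| ≤ |x j / (Real.pi / Λ)| + 1 := by
            have h1 := Int.floor_le (x j / (Real.pi / Λ))
            have h2 := Int.lt_floor_add_one (x j / (Real.pi / Λ))
            simp only [hm, abs_le]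
            constructor <;>
              linarith [neg_abs_le (x j / (Real.pi / Λ)), le_abs_self (x j / (Real.pi / Λ))]
          have hxj : |x j / (Real.pi / Λ)| ≤ Λ / Real.pi * ‖x‖ := by
            rw [abs_div, abs_of_pos (a := Real.pi / Λ) (by positivity), div_div_eq_mul_div,
              mul_comm, mul_div_right_comm]
            exact mul_le_mul_of_nonneg_left (PiLp.norm_apply_le x j) (by positivity)
          have h0 : 0 ≤ Λ / Real.pi := by positivity
          nlinarith [norm_nonneg x]
      _ = ((2 + Λ / Real.pi) * (1 + ‖x‖)) ^ d := by simp
  have hN : ∀ N, |partialSum Λ a (F N) x| ≤ B * (C * ∏ j, (1 + |(m j : ℝ)|)) := by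
    intro N
    rw [hxy, partialSum_eq_expCoeff hΛ]
    refine (hB y hyK _).trans (mul_le_mul_of_nonneg_left ?_ hB0)
    refine TaylorArray.norm_le (by positivity) fun α => ?_
    have hcoeff : TaylorArray.coeff α (∑ n ∈ F N, a n • taylorArray hΛ (n + m)) =
        ∑ n ∈ F N, TaylorArray.coeff α (taylorArray hΛ (n + m)) * a n := by
      rw [map_sum]
      exact Finset.sum_congr rfl fun n _ => by rw [map_smul, smul_eq_mul, mul_comm]
    rw [hcoeff]
    refine (hbound m α N).trans (mul_le_mul_of_nonneg_left ?_ hC)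
    exact mul_le_of_le_one_left (by positivity)
      (pow_le_one₀ (by norm_num : (0 : ℝ) ≤ 1 / 2) (by norm_num))
  refine (le_of_tendsto (hf x).abs (Eventually.of_forall hN)).trans ?_
  rw [mul_assoc, mul_assoc, ← mul_pow]
  gcongr

variable {Ω : Type*} [MeasurableSpace Ω] {P : Measure Ω} [IsProbabilityMeasure P]
  {b : (Fin d → ℤ) → Ω → ℝ}

theorem ae_exists_taylor_bounds (hΛ : 0 < Λ) (hXm : ∀ n, Measurable (b n))
    (hX : ∀ n, MemLp (b n) 2 P) (hmean : ∀ n, ∫ ω, b n ω ∂P = 0) (hvar : ∀ n, Var[b n; P] = 1)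
    (hind : iIndepFun b P) (F : ℕ → Finset (Fin d → ℤ)) (hF : Monotone F) :
    ∀ᵐ ω ∂P, ∃ C : ℝ, ∀ (m : Fin d → ℤ) (α : Fin d → ℕ) N,
      |∑ n ∈ F N, TaylorArray.coeff α (taylorArray hΛ (n + m)) * b n ω| ≤
        C * ((1 / 2) ^ (∑ j, α j) * ∏ j, (1 + |(m j : ℝ)|)) := by
  have h := ae_exists_forall_abs_sum_mul_le (κ := (Fin d → ℤ) × (Fin d → ℕ)) hXm hX hmean hvar hind
    (c := fun k n => TaylorArray.coeff k.2 (taylorArray hΛ (n + k.1)))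
    (v := fun k => (1 / 16) ^ ∑ j, k.2 j)
    (l := fun k => (1 / 2) ^ (∑ j, k.2 j) * ∏ j, (1 + |(k.1 j : ℝ)|))
    (fun k s => sum_sq_coeff_taylorArray_le hΛ k.1 k.2 s) (fun k => by positivity) ?_ F hF
  · filter_upwards [h] with ω ⟨C, hC⟩
    exact ⟨C, fun m α N => hC (m, α) N⟩
  · have hs := (summable_pi_prod (d := d) (fun k : ℤ => by positivity)
      summable_inv_sq_one_add_abs_int).mul_of_nonneg
        (summable_pow_sum (d := d) (by norm_num) (by norm_num : (1 / 4 : ℝ) < 1))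
        (fun m => Finset.prod_nonneg fun j _ => by positivity) (fun α => by positivity)
    refine hs.congr fun k => ?_
    rw [mul_pow, ← pow_mul, mul_comm _ 2, pow_mul, div_mul_eq_div_div, ← div_pow,
      ← Finset.prod_pow, Finset.prod_inv_distrib, mul_comm, ← div_eq_mul_inv]
    norm_num

theorem ae_converges_and_bounded (hΛ : 0 < Λ) (hXm : ∀ n, Measurable (b n))
    (hX : ∀ n, MemLp (b n) 2 P) (hmean : ∀ n, ∫ ω, b n ω ∂P = 0) (hvar : ∀ n, Var[b n; P] = 1)
    (hind : iIndepFun b P) {F : ℕ → Finset (Fin d → ℤ)} (hF : IsExhaustion F) :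
    ∀ᵐ ω ∂P, (∀ r : ℕ, ConvergesLocallyInCr r (fun N => partialSum Λ (fun n => b n ω) (F N))
        (W Λ fun n => b n ω)) ∧
      AnalyticOnNhd ℝ (W Λ fun n => b n ω) Set.univ ∧
      ∃ B : ℝ, ∀ x, |W Λ (fun n => b n ω) x| ≤ B * (1 + ‖x‖) ^ d := by
  have hc : ∀ (α : Fin d → ℕ) (s : Finset (Fin d → ℤ)),
      ∑ n ∈ s, TaylorArray.coeff α (taylorArray hΛ n) ^ 2 ≤ (1 / 16) ^ ∑ j, α j := fun α s => by
    simpa using sum_sq_coeff_taylorArray_le hΛ 0 α s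
  have hbox := isExhaustion_freqBox d
  have hlim := ae_all_iff.2 fun α : Fin d → ℕ =>
    ae_tendsto_sum_mul hXm hX hmean hvar hind (hc α) (freqBox d) hbox.1
  have hdiff := ae_all_iff.2 fun α : Fin d → ℕ =>
    ae_tendsto_sub_sum_mul hXm hX hmean hvar hind (hc α) hF hbox
  filter_upwards [ae_exists_taylor_bounds hΛ hXm hX hmean hvar hind F hF.1,
    ae_exists_taylor_bounds hΛ hXm hX hmean hvar hind (freqBox d) hbox.1, hlim, hdiff]
    with ω ⟨C, hC⟩ ⟨C', hC'⟩ hlim hdiff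
  choose l hl using hlim
  obtain ⟨T, hTl, hT⟩ := exists_tendsto_taylorArray hΛ
    (fun α N => by simpa using hC' 0 α N) hl
  obtain ⟨T', hTl', hT'⟩ := exists_tendsto_taylorArray hΛ
    (fun α N => by simpa using hC 0 α N) (fun α => by simpa using (hdiff α).add (hl α))
  have hW := W_eq_expCoeff hΛ hT
  have hTT : W Λ (fun n => b n ω) =
      expCoeff (TaylorArray.shiftComb (4 * Λ)) (TaylorArray.coeff 0) T' := by
    -- The limits along `F` and along the boxes have the same entries, so `W`, defined by boxes, is
    -- also the limit along `F`.
    have : T = T' := by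
      rw [← sub_eq_zero, ← norm_le_zero_iff]
      exact TaylorArray.norm_le le_rfl fun α => by simp [hTl, hTl']
    rw [hW, this]
  refine ⟨fun r => ?_, ?_, ?_⟩
  · rw [hTT]
    exact convergesLocallyInCr_partialSum hΛ hT' r
  · rw [hW]
    exact analyticOnNhd_expCoeff _ _ _
  · refine exists_abs_le_of_taylor_bounds hΛ hC' fun x => ?_
    rw [hW]
    simp only [partialSum_eq_expCoeff_zero hΛ]
    exact tendsto_expCoeff _ _ hT x

/-- From `(1 + t)² ≤ 2(1 + t²)`, growth of order `d` is absorbed by a weight of order `ρ > d`. -/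
theorem exists_abs_rpow_mul_le {E : Type*} [SeminormedAddCommGroup E] {f : E → ℝ} {B : ℝ}
    (hf : ∀ x, |f x| ≤ B * (1 + ‖x‖) ^ d) {ρ : ℝ} (hρ : (d : ℝ) < ρ) :
    ∃ C : ℝ, ∀ x, |(1 + ‖x‖ ^ 2) ^ (-ρ / 2) * f x| ≤ C := by
  refine ⟨|B| * 2 ^ ((d : ℝ) / 2), fun x => ?_⟩
  have h1 : (1 : ℝ) ≤ 1 + ‖x‖ ^ 2 := by nlinarith [sq_nonneg ‖x‖]
  have hpow : (1 + ‖x‖) ^ d ≤ 2 ^ ((d : ℝ) / 2) * (1 + ‖x‖ ^ 2) ^ ((d : ℝ) / 2) := by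
    rw [← Real.mul_rpow (by norm_num) (by positivity)]
    have hsq : ((1 + ‖x‖) ^ 2) ^ ((d : ℝ) / 2) = (1 + ‖x‖) ^ d := by
      rw [← Real.rpow_natCast, ← Real.rpow_mul (by positivity), ← Real.rpow_natCast]
      congr 1
      push_cast
      ring
    rw [← hsq]
    exact Real.rpow_le_rpow (by positivity) (by nlinarith [sq_nonneg (1 - ‖x‖)]) (by positivity)
  rw [abs_mul, abs_of_nonneg (Real.rpow_nonneg (by positivity) _)]
  have hle : |f x| ≤ |B| * (2 ^ ((d : ℝ) / 2) * (1 + ‖x‖ ^ 2) ^ ((d : ℝ) / 2)) :=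
    (hf x).trans (mul_le_mul (le_abs_self B) hpow (by positivity) (abs_nonneg B))
  have hprod : (1 + ‖x‖ ^ 2) ^ (-ρ / 2) * (1 + ‖x‖ ^ 2) ^ ((d : ℝ) / 2) ≤ 1 := by
    rw [← Real.rpow_add (by positivity)]
    exact Real.rpow_le_one_of_one_le_of_nonpos h1 (by linarith)
  calc (1 + ‖x‖ ^ 2) ^ (-ρ / 2) * |f x|
      ≤ (1 + ‖x‖ ^ 2) ^ (-ρ / 2) *
        (|B| * (2 ^ ((d : ℝ) / 2) * (1 + ‖x‖ ^ 2) ^ ((d : ℝ) / 2))) := by gcongr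
    _ = |B| * 2 ^ ((d : ℝ) / 2) *
        ((1 + ‖x‖ ^ 2) ^ (-ρ / 2) * (1 + ‖x‖ ^ 2) ^ ((d : ℝ) / 2)) := by ring
    _ ≤ |B| * 2 ^ ((d : ℝ) / 2) := mul_le_of_le_one_right (by positivity) hprod

end AlmostSure

end RandomPotential

theorem proposition2p1 (d : ℕ) (Λ : ℝ) (hΛ : 0 < Λ)
    {Ω : Type*} [MeasurableSpace Ω] (P : Measure Ω) [IsProbabilityMeasure P]
    (b : (Fin d → ℤ) → Ω → ℝ)
    (hb : ∀ n, HasLaw (b n) (gaussianReal 0 1) P) (hindep : iIndepFun b P) :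
    (∀ F : ℕ → Finset (Fin d → ℤ), RandomPotential.IsExhaustion F →
      ∀ᵐ ω ∂P, ∀ r : ℕ, RandomPotential.ConvergesLocallyInCr r
        (fun N => RandomPotential.partialSum Λ (fun n => b n ω) (F N))
        (RandomPotential.W Λ fun n => b n ω)) ∧
    (∀ᵐ ω ∂P, AnalyticOnNhd ℝ (RandomPotential.W Λ fun n => b n ω) Set.univ) ∧
    (∀ᵐ ω ∂P, ∀ ρ : ℝ, (d : ℝ) < ρ → ∃ C : ℝ, ∀ x : EuclideanSpace ℝ (Fin d),
      |(1 + ‖x‖ ^ 2) ^ (-ρ / 2) * RandomPotential.W Λ (fun n => b n ω) x| ≤ C) := by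
  -- `HasLaw` gives only almost everywhere measurability. Measurable versions are used instead; as
  -- `ℤ^d` is countable, all of them agree with `b` off a single null set.
  set b' : (Fin d → ℤ) → Ω → ℝ := fun n => (hb n).aemeasurable.mk (b n)
  have hbb : ∀ n, b n =ᵐ[P] b' n := fun n => (hb n).aemeasurable.ae_eq_mk
  have hlaw : ∀ n, HasLaw (b' n) (gaussianReal 0 1) P := fun n => (hb n).congr (hbb n).symm
  have hall : ∀ᵐ ω ∂P, (fun n => b n ω) = fun n => b' n ω :=
    (ae_all_iff.2 hbb).mono fun ω h => funext h
  have key : ∀ F : ℕ → Finset (Fin d → ℤ), RandomPotential.IsExhaustion F → _ := fun F hF =>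
    RandomPotential.ae_converges_and_bounded (P := P) hΛ
      (fun n => (hb n).aemeasurable.measurable_mk)
      (fun n => by
        have h := memLp_id_gaussianReal' (μ := 0) (v := 1) 2 (by norm_num)
        rw [← (hlaw n).map_eq] at h
        exact h.comp_of_map (hlaw n).aemeasurable)
      (fun n => by rw [(hlaw n).integral_eq, integral_id_gaussianReal])
      (fun n => by rw [(hlaw n).variance_eq, variance_id_gaussianReal, NNReal.coe_one])
      ((iIndepFun_congr hbb).1 hindep) hF
  have hbox := key _ (RandomPotential.isExhaustion_freqBox d)
  refine ⟨fun F hF => ?_, ?_, ?_⟩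
  · filter_upwards [key F hF, hall] with ω h he
    rw [he]
    exact h.1
  · filter_upwards [hbox, hall] with ω h he
    rw [he]
    exact h.2.1
  · filter_upwards [hbox, hall] with ω ⟨_, _, B, hB⟩ he ρ hρ
    rw [he]
    exact RandomPotential.exists_abs_rpow_mul_le hB hρ
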